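/- Let $G=(U\cup W,E)$ be a finite simple bi-regular bipartite graph: $U$ and $W$ are disjoint, every edge joins $U$ to $W$, each vertex of $U$ has degree $q_1+1$ and each vertex of $W$ has degree $q_2+1$, where $q_1,q_2\ge 0$ are integers. Let $H$ be its biadjacency matrix (rows indexed by $W$, columns by $U$), let $\sum\lambda^k$ be the sum of the $k$-th powers of the eigenvalues of $HH^{\mathsf T}$ counted with multiplicity, let $N_{2k}$ be the number of cycles of length $2k$ in $G$ (as subgraphs), and let $g$ be the girth of $G$ ($g=\infty$ if $G$ has no cycle). Then: 1. If $g\ge 4$, then $$N_4=\frac{\sum\lambda^2-|E|A_4}{4},\qquad N_6=-2(q_1+q_2)N_4+\frac{\sum\lambda^3-|E|A_6}{6}.$$ 2. If $g\ge 6$, then $$N_8=-3(q_1+q_2)N_6+\frac{\sum\lambda^4-|E|A_8}{8},$$ $$N_{10}=-4(q_1+q_2)N_8-3\left(2(q_1+q_2)^2+q_1q_2\right)N_6+\frac{\sum\lambda^5-|E|A_{10}}{10}.$$ 3. If $g\ge 8$, then $$N_{12}=-5(q_1+q_2)N_{10}-2\left(5(q_1+q_2)^2+2q_1q_2\right)N_8+\frac{\sum\lambda^6-|E|A_{12}}{12},$$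 $$N_{14}=-6(q_1+q_2)N_{12}-5\left(3(q_1+q_2)^2+q_1q_2\right)N_{10}-4(q_1+q_2)\left(5(q_1+q_2)^2+6q_1q_2\right)N_8+\frac{\sum\lambda^7-|E|A_{14}}{14}.$$ Here $\frac{q_1^k-q_2^k}{q_1-q_2}$ stands for $\sum_{i=0}^{k-1}q_1^iq_2^{k-1-i}$ (also when $q_1=q_2$), and $$A_4=q_1+q_2+1,\qquad A_6=(q_1+q_2+1)^2+q_1q_2,\qquad A_8=(q_1+q_2+1)^3+q_1q_2(3q_1+3q_2+2),$$ $$A_{10}=-1+\frac{q_1^5+1}{q_1+1}+\frac{q_2^5+1}{q_2+1}-5\frac{q_1^5-q_2^5}{q_1-q_2}+5(q_1+q_2)A_8-a_{5,3}A_6+a_{5,2}A_4,$$ $$A_{12}=-1-\frac{q_1^6-1}{q_1+1}-\frac{q_2^6-1}{q_2+1}+6\frac{q_1^6-q_2^6}{q_1-q_2}+6(q_1+q_2)A_{10}-a_{6,4}A_8+a_{6,3}A_6-a_{6,2}A_4,$$ $$A_{14}=-1+\frac{q_1^7+1}{q_1+1}+\frac{q_2^7+1}{q_2+1}-7\frac{q_1^7-q_2^7}{q_1-q_2}+7(q_1+q_2)A_{12}-a_{7,5}A_{10}+a_{7,4}A_8-a_{7,3}A_6+a_{7,2}A_4,$$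 with $$a_{5,3}=10(q_1+q_2)^2-5q_1q_2,\qquad a_{5,2}=10(q_1+q_2)^3-15q_1q_2(q_1+q_2),$$ $$a_{6,4}=15(q_1+q_2)^2-6q_1q_2,\qquad a_{6,3}=20(q_1+q_2)^3-24q_1q_2(q_1+q_2),$$ $$a_{6,2}=15(q_1+q_2)^4-36q_1q_2(q_1+q_2)^2+9q_1^2q_2^2,$$ $$a_{7,5}=21(q_1+q_2)^2-7q_1q_2,\qquad a_{7,4}=35(q_1+q_2)^3-35q_1q_2(q_1+q_2),$$ $$a_{7,3}=35(q_1+q_2)^4-70q_1q_2(q_1+q_2)^2+14q_1^2q_2^2,$$ $$a_{7,2}=21(q_1+q_2)^5-70q_1q_2(q_1+q_2)^3+42q_1^2q_2^2(q_1+q_2).$$ -/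

import Mathlib

namespace BiregularCycles

/-- `G` is a bipartite graph with vertex set `U ∪ W` (`U`, `W` disjoint, every edge joins `U` to
`W`) in which each vertex of `U` has degree `q₁ + 1` and each vertex of `W` has degree
`q₂ + 1`. -/
structure IsBiregularBipartite {V : Type*} [Fintype V] [DecidableEq V] (G : SimpleGraph V)
    [DecidableRel G.Adj] (U W : Finset V) (q₁ q₂ : ℕ) : Prop where
  bipartite : G.IsBipartiteWith (U : Set V) (W : Set V)
  cover : U ∪ W = Finset.univ
  degree_left : ∀ u ∈ U, G.degree u = q₁ + 1
  degree_right : ∀ w ∈ W, G.degree w = q₂ + 1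

/-- The biadjacency (parity-check) matrix `H` of a bipartite graph, as a real `0/1` matrix with
rows indexed by `W` and columns indexed by `U`. -/
def biadjMatrix {V : Type*} (G : SimpleGraph V) [DecidableRel G.Adj] (U W : Finset V) :
    Matrix W U ℝ :=
  Matrix.of fun w u => if G.Adj w u then 1 else 0

theorem isHermitian_biadj {V : Type*} (G : SimpleGraph V) [DecidableRel G.Adj]
    (U W : Finset V) :
    (biadjMatrix G U W * (biadjMatrix G U W).transpose).IsHermitian := by
  simpa [Matrix.conjTranspose_eq_transpose_of_trivial] using
    Matrix.isHermitian_mul_conjTranspose_self (biadjMatrix G U W)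

/-- `∑ λ ^ k`, where `λ` runs through the eigenvalues of `H Hᵀ`, counted with multiplicity. -/
noncomputable def eigenvaluePowerSum {V : Type*} [DecidableEq V] (G : SimpleGraph V)
    [DecidableRel G.Adj] (U W : Finset V) (k : ℕ) : ℝ :=
  ∑ w : W, (isHermitian_biadj G U W).eigenvalues w ^ k

/-- The number `N_ℓ` of cycles of length `ℓ` in `G`. A cycle is identified with the subgraph
traced by a closed walk that is a cycle, so neither starting point nor orientation matters. -/
noncomputable def numCycles {V : Type*} (G : SimpleGraph V) (l : ℕ) : ℕ :=
  Set.ncard {C : G.Subgraph | ∃ (v : V) (c : G.Walk v v),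
    c.IsCycle ∧ c.length = l ∧ c.toSubgraph = C}

/-- The quotient `(x ^ k - y ^ k) / (x - y)`, read as the polynomial
`x ^ (k - 1) + x ^ (k - 2) * y + ⋯ + y ^ (k - 1)`, so that it also makes sense for `x = y`. -/
def powQuot (k : ℕ) (x y : ℝ) : ℝ :=
  ∑ i ∈ Finset.range k, x ^ i * y ^ (k - 1 - i)

theorem powQuot_eq_div (k : ℕ) {x y : ℝ} (h : x ≠ y) :
    powQuot k x y = (x ^ k - y ^ k) / (x - y) :=
  (Commute.all x y).geom_sum₂ h k

/-- `A₄`, as a function of `q₁ = x` and `q₂ = y`. -/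
def A4 (x y : ℝ) : ℝ := x + y + 1

/-- `A₆` -/
def A6 (x y : ℝ) : ℝ := (x + y + 1) ^ 2 + x * y

/-- `A₈` -/
def A8 (x y : ℝ) : ℝ := (x + y + 1) ^ 3 + x * y * (3 * x + 3 * y + 2)

/-- `a_{5,3}` -/
def a53 (x y : ℝ) : ℝ := 10 * (x + y) ^ 2 - 5 * (x * y)

/-- `a_{5,2}` -/
def a52 (x y : ℝ) : ℝ := 10 * (x + y) ^ 3 - 15 * (x * y) * (x + y)

/-- `A₁₀` -/
noncomputable def A10 (x y : ℝ) : ℝ :=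
  -1 + (x ^ 5 + 1) / (x + 1) + (y ^ 5 + 1) / (y + 1) - 5 * powQuot 5 x y
    + 5 * (x + y) * A8 x y - a53 x y * A6 x y + a52 x y * A4 x y

/-- `a_{6,4}` -/
def a64 (x y : ℝ) : ℝ := 15 * (x + y) ^ 2 - 6 * (x * y)

/-- `a_{6,3}` -/
def a63 (x y : ℝ) : ℝ := 20 * (x + y) ^ 3 - 24 * (x * y) * (x + y)

/-- `a_{6,2}` -/
def a62 (x y : ℝ) : ℝ :=
  15 * (x + y) ^ 4 - 36 * (x * y) * (x + y) ^ 2 + 9 * (x ^ 2 * y ^ 2)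

/-- `A₁₂` -/
noncomputable def A12 (x y : ℝ) : ℝ :=
  -1 - (x ^ 6 - 1) / (x + 1) - (y ^ 6 - 1) / (y + 1) + 6 * powQuot 6 x y
    + 6 * (x + y) * A10 x y - a64 x y * A8 x y + a63 x y * A6 x y - a62 x y * A4 x y

/-- `a_{7,5}` -/
def a75 (x y : ℝ) : ℝ := 21 * (x + y) ^ 2 - 7 * (x * y)

/-- `a_{7,4}` -/
def a74 (x y : ℝ) : ℝ := 35 * (x + y) ^ 3 - 35 * (x * y) * (x + y)

/-- `a_{7,3}` -/
def a73 (x y : ℝ) : ℝ :=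
  35 * (x + y) ^ 4 - 70 * (x * y) * (x + y) ^ 2 + 14 * (x ^ 2 * y ^ 2)

/-- `a_{7,2}` -/
def a72 (x y : ℝ) : ℝ :=
  21 * (x + y) ^ 5 - 70 * (x * y) * (x + y) ^ 3 + 42 * (x ^ 2 * y ^ 2) * (x + y)

/-- `A₁₄` -/
noncomputable def A14 (x y : ℝ) : ℝ :=
  -1 + (x ^ 7 + 1) / (x + 1) + (y ^ 7 + 1) / (y + 1) - 7 * powQuot 7 x y
    + 7 * (x + y) * A12 x y - a75 x y * A10 x y + a74 x y * A8 x y - a73 x y * A6 x y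
    + a72 x y * A4 x y

end BiregularCycles

/-! ### Nonbacktracking walks, girth and cycles. -/

namespace SimpleGraph

open BiregularCycles

variable {V : Type*} {G : SimpleGraph V}

/-! Let `B` be the Hashimoto matrix on darts. `tr B ^ n` counts the cyclic sequences of `n` vertices
that backtrack nowhere. A repeated vertex splits such a sequence into two arcs, each at least as
long as the girth `g`. So for `3 ≤ n < 2g` all of them are cycles, and `tr B ^ n = 2n * N_n`
(`card_cyclicNonbacktracking`).

The same traces are computable from the spectrum. Write `B = P * Q - J`, with `J` the reversal of
darts, `Q * P` the adjacency matrix `A` and `Q * J * P` the degree matrix. The matrices `Q * B ^ k *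
P` count nonbacktracking walks and satisfy a three-term recurrence. Peeling off a tail edge relates
their traces to `tr B ^ n` (`trace_hashimoto_pow_recurrence`). On one side of a biregular graph the
degree is a scalar and `A ^ 2` preserves the side, so everything reduces to the traces of powers of
`A ^ 2` on that side, which are the eigenvalue power sums.

The resulting recurrence is linear. Solving it for each power sum `S k` produces `|E| A_{2k}` plus
multiples of the cycle counts. -/

theorem exists_walk_of_adj_succ (f : ℕ → V) (h : ∀ i, G.Adj (f i) (f (i + 1))) (n : ℕ) :
    ∃ p : G.Walk (f 0) (f n), p.length = n ∧ ∀ i ≤ n, p.getVert i = f i := by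
  induction n generalizing f with
  | zero => exact ⟨.nil, rfl, by simp⟩
  | succ n ih =>
    obtain ⟨p, hp, hv⟩ := ih (fun i => f (i + 1)) (fun i => h (i + 1))
    refine ⟨.cons (h 0) p, by simp [hp], fun i hi => ?_⟩
    cases i with
    | zero => simp
    | succ i => simpa using hv i (by omega)

theorem exists_isCycle_of_injOn (f : ℕ → V) (h : ∀ i, G.Adj (f i) (f (i + 1))) {n : ℕ}
    (hn : 3 ≤ n) (hf : f n = f 0) (hinj : Set.InjOn f {i | i < n}) :
    ∃ c : G.Walk (f 0) (f 0), c.IsCycle ∧ c.length = n ∧ ∀ i ≤ n, c.getVert i = f i := by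
  obtain ⟨p, hp, hv⟩ := exists_walk_of_adj_succ f h n
  refine ⟨p.copy rfl hf, ?_, by simpa, by simpa using hv⟩
  rw [Walk.isCycle_iff_isPath_tail_and_le_length]
  refine ⟨?_, by simpa [hp] using hn⟩
  have hl : ((p.copy rfl hf).tail).length = n - 1 := by
    have := Walk.length_tail_add_one (p := p.copy rfl hf) (by
      rw [Walk.not_nil_iff_lt_length]; simp [hp]; omega)
    simp only [Walk.length_copy, hp] at this
    omega
  rw [← Walk.IsPath.getVert_injOn_iff, hl]
  have key : ∀ i ≤ n - 1, (p.copy rfl hf).tail.getVert i = f (i + 1) := fun i hi => by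
    simpa [Walk.getVert_tail] using hv (i + 1) (by omega)
  -- The tail visits positions `1, …, n`; renaming position `n` to `0` brings all indices into the
  -- range where `f` is injective.
  have key2 : ∀ i ≤ n - 1, f (i + 1) = f (if i + 1 = n then 0 else i + 1) := fun i hi => by
    split_ifs with h1
    · rw [h1, hf]
    · rfl
  intro i hi j hj hij
  simp only [Set.mem_ofPred_eq] at hi hj
  rw [key i hi, key j hj, key2 i hi, key2 j hj] at hij
  have := hinj (by simp only [Set.mem_ofPred_eq]; split_ifs <;> omega)
    (by simp only [Set.mem_ofPred_eq]; split_ifs <;> omega) hij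
  split_ifs at this <;> omega

/-- A nonbacktracking walk that returns to a vertex after `a` steps contains a cycle of length
at most `a`. -/
theorem egirth_le_of_nonbacktracking (f : ℕ → V) (h : ∀ i, G.Adj (f i) (f (i + 1)))
    (hnb : ∀ i, f i ≠ f (i + 2)) {i a : ℕ} (ha : 0 < a) (hi : f (i + a) = f i) :
    G.egirth ≤ a := by
  classical
  -- Take the shortest return time over all starting points. A coincidence inside that window would
  -- be a shorter return, so the window is a cycle; return times 1 and 2 would be a loop and a
  -- backtrack.
  have hex : ∃ a, 0 < a ∧ ∃ i, f (i + a) = f i := ⟨a, ha, i, hi⟩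
  obtain ⟨h0, j, hj⟩ := Nat.find_spec hex
  have hle : Nat.find hex ≤ a := Nat.find_min' hex ⟨ha, i, hi⟩
  have hmin : ∀ b j, 0 < b → f (j + b) = f j → Nat.find hex ≤ b := fun b j hb hj =>
    Nat.find_min' hex ⟨hb, j, hj⟩
  generalize Nat.find hex = b at *
  have h1 : b ≠ 1 := by rintro rfl; exact (h j).ne hj.symm
  have h2 : b ≠ 2 := by rintro rfl; exact hnb j hj.symm
  have hlt : ∀ m n, m < n → n < b → f (j + m) ≠ f (j + n) := fun m n hmn hn he => by
    have := hmin (n - m) (j + m) (by omega) (by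
      rw [show j + m + (n - m) = j + n by omega, he])
    omega
  obtain ⟨c, hc, hcl, -⟩ := exists_isCycle_of_injOn (fun i => f (j + i))
    (fun i => h (j + i)) (n := b) (by omega) hj (fun m hm n hn he => by
      rcases lt_trichotomy m n with hmn | hmn | hmn
      · exact absurd he (hlt m n hmn hn)
      · exact hmn
      · exact absurd he.symm (hlt n m hmn hm))
  calc G.egirth ≤ c.length := egirth_le_length hc
    _ ≤ a := by rw [hcl]; exact_mod_cast hle

variable {n : ℕ}

/-- Closed walks, as cyclic sequences of vertices, that backtrack nowhere (not even at the
base point). -/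
def IsCyclicNonbacktracking (G : SimpleGraph V) (f : ZMod n → V) : Prop :=
  ∀ i, G.Adj (f i) (f (i + 1)) ∧ f i ≠ f (i + 2)

/-- If `f a = f b`, the two arcs between `a` and `b` are returns of the `n`-periodic extension of
`f`. Each has length at least `g`, yet they add up to `n < 2g`. -/
theorem IsCyclicNonbacktracking.injective [NeZero n] {f : ZMod n → V}
    (hf : G.IsCyclicNonbacktracking f) {g : ℕ} (hg : (g : ℕ∞) ≤ G.egirth) (hn : n < 2 * g) :
    Function.Injective f := by
  intro a b hab
  by_contra hne
  have key : ∀ (c : ZMod n) (d : ℕ), 0 < d → f (c + d) = f c → g ≤ d := fun c d hd hcd => by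
    have := egirth_le_of_nonbacktracking (G := G) (fun m : ℕ => f (m : ZMod n))
      (fun m => by simpa using (hf m).1) (fun m => by simpa using (hf m).2) (i := c.val) hd
      (by simpa using hcd)
    exact_mod_cast hg.trans this
  have hd : (b - a).val ≠ 0 := by
    rw [Ne, ZMod.val_eq_zero, sub_eq_zero]; exact fun h => hne h.symm
  have hdn := ZMod.val_lt (b - a)
  have h1 := key a (b - a).val (by omega) (by simp [hab])
  have h2 := key b (n - (b - a).val) (by omega) (by
    rw [Nat.cast_sub hdn.le]; simp [hab])
  omega

/-- The subgraph traced by a cyclic sequence of adjacent vertices. -/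
def cyclicSubgraph (f : ZMod n → V) (h : ∀ i, G.Adj (f i) (f (i + 1))) : G.Subgraph where
  verts := Set.range f
  Adj u v := ∃ i, s(f i, f (i + 1)) = s(u, v)
  adj_sub := by
    rintro u v ⟨i, hi⟩
    rw [← G.mem_edgeSet, ← hi]
    exact h i
  edge_vert := by
    rintro u v ⟨i, hi⟩
    rcases Sym2.eq_iff.mp hi with ⟨rfl, -⟩ | ⟨-, rfl⟩
    exacts [⟨_, rfl⟩, ⟨_, rfl⟩]
  symm := ⟨by
    rintro u v ⟨i, hi⟩
    exact ⟨i, hi.trans Sym2.eq_swap⟩⟩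

theorem toSubgraph_eq_cyclicSubgraph [NeZero n] (f : ZMod n → V)
    (h : ∀ i, G.Adj (f i) (f (i + 1))) {v : V} (c : G.Walk v v) (hl : c.length = n)
    (hc : ∀ i ≤ n, c.getVert i = f i) : c.toSubgraph = cyclicSubgraph f h := by
  ext u w
  · rw [Walk.mem_verts_toSubgraph, Walk.mem_support_iff_exists_getVert]
    constructor
    · rintro ⟨i, rfl, hi⟩
      exact ⟨i, (hc i (hl ▸ hi)).symm⟩
    · rintro ⟨i, rfl⟩
      exact ⟨i.val, by rw [hc _ (ZMod.val_lt i).le]; simp, hl ▸ (ZMod.val_lt i).le⟩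
  · rw [Walk.toSubgraph_adj_iff]
    constructor
    · rintro ⟨i, hi, hil⟩
      rw [hc i (by omega), hc (i + 1) (by omega)] at hi
      exact ⟨i, by simpa using hi⟩
    · rintro ⟨i, hi⟩
      have := ZMod.val_lt i
      refine ⟨i.val, ?_, by omega⟩
      rw [hc _ (by omega), hc _ (by omega)]
      simpa using hi

/-! ### Rooted oriented cycles and the dihedral action. -/

/-- Injective cyclic sequences of adjacent vertices: rooted oriented cycles. -/
abbrev RootedCycle (G : SimpleGraph V) (n : ℕ) :=
  {f : ZMod n → V // Function.Injective f ∧ ∀ i, G.Adj (f i) (f (i + 1))}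

/-- The underlying subgraph of a rooted oriented cycle. -/
def RootedCycle.subgraph (f : RootedCycle G n) : G.Subgraph := cyclicSubgraph f.1 f.2.2

theorem setOf_cycle_subgraph_eq_range (hn : 3 ≤ n) :
    {C : G.Subgraph | ∃ (v : V) (c : G.Walk v v), c.IsCycle ∧ c.length = n ∧ c.toSubgraph = C} =
      Set.range (RootedCycle.subgraph (G := G) (n := n)) := by
  have : NeZero n := ⟨by omega⟩
  ext C
  constructor
  · rintro ⟨v, c, hc, hl, rfl⟩
    have hval : ∀ i ≤ n, c.getVert i = c.getVert (i : ZMod n).val := fun i hi => by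
      rcases hi.lt_or_eq with h | rfl
      · rw [ZMod.val_cast_of_lt h]
      · simp only [CharP.cast_eq_zero, ZMod.val_zero, Walk.getVert_zero]
        rw [← hl, Walk.getVert_length]
    refine ⟨⟨fun i => c.getVert i.val, fun i j hij => ?_, fun i => ?_⟩, ?_⟩
    · refine ZMod.val_injective n (hc.getVert_injOn' ?_ ?_ hij)
      · have := ZMod.val_lt i; simp only [Set.mem_ofPred_eq]; omega
      · have := ZMod.val_lt j; simp only [Set.mem_ofPred_eq]; omega
    · have := hval (i.val + 1) (ZMod.val_lt i)
      simp only [Nat.cast_add, ZMod.natCast_val, ZMod.cast_id', id_eq, Nat.cast_one] at this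
      beta_reduce; rw [← this]
      exact c.adj_getVert_succ (hl ▸ ZMod.val_lt i)
    · exact (toSubgraph_eq_cyclicSubgraph _ _ c hl hval).symm
  · rintro ⟨f, rfl⟩
    obtain ⟨c, hc, hl, hv⟩ := exists_isCycle_of_injOn (fun m : ℕ => f.1 (m : ZMod n))
      (fun m => by simpa using f.2.2 m) hn (by simp) (fun i hi j hj hij => by
        have := congrArg ZMod.val (f.2.1 hij)
        rwa [ZMod.val_cast_of_lt hi, ZMod.val_cast_of_lt hj] at this)
    exact ⟨_, c, hc, hl, toSubgraph_eq_cyclicSubgraph _ _ c hl hv⟩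

theorem cyclicSubgraph_adj_apply {f : ZMod n → V} (hinj : Function.Injective f)
    {h : ∀ i, G.Adj (f i) (f (i + 1))} {a : ZMod n} {w : V}
    (hw : (cyclicSubgraph f h).Adj (f a) w) : w = f (a + 1) ∨ w = f (a - 1) := by
  obtain ⟨i, hi⟩ := hw
  rcases Sym2.eq_iff.mp hi with ⟨h1, rfl⟩ | ⟨rfl, h1⟩
  · rw [hinj h1]; exact .inl rfl
  · rw [← hinj h1]; right; congr 1; ring

/-- The rotation by `r`, possibly composed with a reflection, of a rooted oriented cycle. -/
def RootedCycle.dihedral (f : RootedCycle G n) (r : ZMod n × Bool) : RootedCycle G n :=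
  ⟨fun i => f.1 (r.1 + (if r.2 then 1 else -1) * i), fun i j hij => by
    have := f.2.1 hij
    rcases r with ⟨r, (_ | _)⟩ <;> simpa using this, fun i => by
    rcases r with ⟨r, (_ | _)⟩
    · have := (f.2.2 (r - (i + 1))).symm
      simp only [Bool.false_eq_true, if_false]
      convert this using 2 <;> ring
    · have := f.2.2 (r + i)
      simp only [if_true]
      convert this using 2 <;> ring⟩

theorem two_ne_zero_zmod (hn : 3 ≤ n) : (2 : ZMod n) ≠ 0 := fun h => by
  have h2 : ((2 : ℕ) : ZMod n) = 0 := by exact_mod_cast h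
  have := Nat.le_of_dvd (by norm_num) ((ZMod.natCast_eq_zero_iff 2 n).mp h2)
  omega

theorem RootedCycle.dihedral_injective (hn : 3 ≤ n) (f : RootedCycle G n) :
    Function.Injective f.dihedral := by
  rintro ⟨r, b⟩ ⟨r', b'⟩ h
  have h' : ∀ i : ZMod n, r + (if b then 1 else -1) * i = r' + (if b' then 1 else -1) * i :=
    fun i => f.2.1 (congrFun (congrArg Subtype.val h) i)
  have h0 : r = r' := by simpa using h' 0
  subst h0
  have h1 := h' 1
  have h2 := two_ne_zero_zmod hn
  rcases b with (_ | _) <;> rcases b' with (_ | _) <;> simp at h1 ⊢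
  · exact h2 (by linear_combination -h1)
  · exact h2 (by linear_combination h1)

theorem RootedCycle.subgraph_dihedral (f : RootedCycle G n) (r : ZMod n × Bool) :
    (f.dihedral r).subgraph = f.subgraph := by
  rcases r with ⟨r, (_ | _)⟩
  · ext u w
    · constructor
      · rintro ⟨i, rfl⟩; exact ⟨_, rfl⟩
      · rintro ⟨i, rfl⟩; exact ⟨r - i, by simp [dihedral]⟩
    · constructor
      · rintro ⟨i, hi⟩
        refine ⟨r - (i + 1), ?_⟩
        rw [← hi, Sym2.eq_swap]
        simp only [dihedral, Bool.false_eq_true, if_false]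
        congr 3 <;> ring_nf
      · rintro ⟨i, hi⟩
        refine ⟨r - (i + 1), ?_⟩
        rw [← hi, Sym2.eq_swap]
        simp only [dihedral, Bool.false_eq_true, if_false]
        congr 3 <;> ring_nf
  · ext u w
    · constructor
      · rintro ⟨i, rfl⟩; exact ⟨_, rfl⟩
      · rintro ⟨i, rfl⟩; exact ⟨i - r, by simp [dihedral]⟩
    · constructor
      · rintro ⟨i, hi⟩
        refine ⟨r + i, ?_⟩
        rw [← hi]
        simp only [dihedral, if_true]
        congr 3 <;> ring_nf
      · rintro ⟨i, hi⟩
        refine ⟨i - r, ?_⟩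
        rw [← hi]
        simp only [dihedral, if_true]
        congr 3 <;> ring_nf

/-- The starting vertex fixes the rotation and the second vertex fixes the direction. After that,
each vertex has only two neighbours in the subgraph, and injectivity rules out going back. -/
theorem RootedCycle.exists_dihedral_eq (hn : 3 ≤ n) (f f' : RootedCycle G n)
    (h : f'.subgraph = f.subgraph) : ∃ r, f.dihedral r = f' := by
  have : NeZero n := ⟨by omega⟩
  have hadj : ∀ i, f.subgraph.Adj (f'.1 i) (f'.1 (i + 1)) := fun i => by
    rw [← h]; exact ⟨i, rfl⟩
  obtain ⟨r, hr⟩ : f'.1 0 ∈ Set.range f.1 := by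
    change f'.1 0 ∈ f.subgraph.verts
    rw [← h]; exact ⟨0, rfl⟩
  obtain ⟨b, hb⟩ : ∃ b : Bool, f'.1 1 = f.1 (r + if b then 1 else -1) := by
    have h0 := hadj 0
    rw [← hr, zero_add] at h0
    rcases cyclicSubgraph_adj_apply f.2.1 h0 with h1 | h1
    · exact ⟨true, by simpa using h1⟩
    · exact ⟨false, by simpa [sub_eq_add_neg] using h1⟩
  refine ⟨⟨r, b⟩, Subtype.ext (funext fun i => ?_)⟩
  -- Two consecutive positions are carried along, since the next vertex is forced only once the
  -- previous one is known.
  have key : ∀ m : ℕ, f.1 (r + (if b then 1 else -1) * m) = f'.1 m ∧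
      f.1 (r + (if b then 1 else -1) * (m + 1)) = f'.1 (m + 1) := by
    intro m
    induction m with
    | zero => simp [hr, hb]
    | succ m ih =>
      refine ⟨by simpa using ih.2, ?_⟩
      have h1 := hadj (m + 1)
      rw [← ih.2] at h1
      have hne : f'.1 (m + 1 + 1) ≠ f'.1 m := fun he => two_ne_zero_zmod hn (by
        have := f'.2.1 he
        linear_combination this)
      rw [← ih.1] at hne
      push_cast
      rcases b with (_ | _) <;> simp only [Bool.false_eq_true, if_false, if_true] at * <;>
        rcases cyclicSubgraph_adj_apply f.2.1 h1 with h2 | h2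
      · exact absurd (h2.trans (congrArg f.1 (by ring))) hne
      · exact (h2.trans (congrArg f.1 (by ring))).symm
      · exact (h2.trans (congrArg f.1 (by ring))).symm
      · exact absurd (h2.trans (congrArg f.1 (by ring))) hne
  have := (key i.val).1
  simpa [RootedCycle.dihedral] using this

/-- The fibres of `RootedCycle.subgraph` are free dihedral orbits, of size `2 * n`. -/
theorem card_rootedCycle [Fintype V] (hn : 3 ≤ n) :
    Nat.card (RootedCycle G n) = 2 * n * numCycles G n := by
  classical
  have : NeZero n := ⟨by omega⟩
  have hfib : ∀ f : RootedCycle G n,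
      (Finset.univ.filter fun f' : RootedCycle G n => f'.subgraph = f.subgraph).card = 2 * n := by
    intro f
    have : (Finset.univ.filter fun f' : RootedCycle G n => f'.subgraph = f.subgraph) =
        Finset.univ.image f.dihedral := by
      ext f'
      simp only [Finset.mem_filter, Finset.mem_univ, true_and, Finset.mem_image]
      exact ⟨fun h => f.exists_dihedral_eq hn f' h, fun ⟨r, hr⟩ => hr ▸ f.subgraph_dihedral r⟩
    rw [this, Finset.card_image_of_injective _ (f.dihedral_injective hn)]
    simp [ZMod.card, mul_comm]
  rw [numCycles, setOf_cycle_subgraph_eq_range hn, Nat.card_eq_fintype_card, ← Finset.card_univ,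
    Finset.card_eq_sum_card_image RootedCycle.subgraph, Finset.sum_const_nat (m := 2 * n),
    mul_comm, ← Set.ncard_coe_finset]
  · simp
  · intro C hC
    obtain ⟨f, -, rfl⟩ := Finset.mem_image.mp hC
    exact hfib f

/-- Below twice the girth, the closed walks without backtracking trace cycles. -/
theorem card_cyclicNonbacktracking [Fintype V] (hn : 3 ≤ n) {g : ℕ} (hg : (g : ℕ∞) ≤ G.egirth)
    (hng : n < 2 * g) :
    Nat.card {f : ZMod n → V // G.IsCyclicNonbacktracking f} = 2 * n * numCycles G n := by
  have : NeZero n := ⟨by omega⟩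
  rw [← card_rootedCycle hn]
  refine Nat.card_congr (Equiv.subtypeEquivRight fun f =>
    ⟨fun h => ⟨h.injective hg hng, fun i => (h i).1⟩, fun h i => ⟨h.2 i, fun he => ?_⟩⟩)
  exact two_ne_zero_zmod hn (by simpa using (h.1 he).symm)

end SimpleGraph

/-! ### Traces of powers, and identities for `P * Q - J` with `J` an involution. -/

namespace Matrix

variable {α R : Type*} [Fintype α] [DecidableEq α] [CommRing R]

/-- Here `p` lists the interior vertices of a walk, `Fin.cons a p` the sources of its steps and
`Fin.snoc p b` their targets. -/
theorem pow_succ_apply_eq_sum_prod (M : Matrix α α R) (n : ℕ) (a b : α) :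
    (M ^ (n + 1)) a b = ∑ p : Fin n → α, ∏ k : Fin (n + 1),
      M ((Fin.cons a p : Fin (n + 1) → α) k) ((Fin.snoc p b : Fin (n + 1) → α) k) := by
  induction n generalizing a with
  | zero => simp [Fin.snoc]
  | succ n ih =>
    rw [pow_succ', mul_apply, ← (Fin.consEquiv fun _ : Fin (n + 1) => α).sum_comp,
      Fintype.sum_prod_type]
    refine Finset.sum_congr rfl fun l _ => ?_
    rw [ih, Finset.mul_sum]
    refine Finset.sum_congr rfl fun p _ => ?_
    rw [Fin.prod_univ_succ (n := n + 1)]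
    change _ = M a ((Fin.snoc (Fin.cons l p : Fin (n + 1) → α) b : Fin (n + 2) → α) 0) *
      ∏ k : Fin (n + 1), M ((Fin.cons l p : Fin (n + 1) → α) k)
        ((Fin.snoc (Fin.cons l p : Fin (n + 1) → α) b : Fin (n + 2) → α) k.succ)
    rw [← Fin.cons_snoc_eq_snoc_cons]
    simp only [Fin.cons_zero, Fin.cons_succ]

/-- The trace of a power is a sum over cyclic sequences. -/
theorem trace_pow_eq_sum_prod (M : Matrix α α R) (n : ℕ) [NeZero n] :
    (M ^ n).trace = ∑ q : ZMod n → α, ∏ k : ZMod n, M (q k) (q (k + 1)) := by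
  obtain _ | n := n
  · exact absurd rfl (NeZero.ne 0)
  change _ = ∑ q : Fin (n + 1) → α, ∏ k : Fin (n + 1), M (q k) (q (k + 1))
  rw [trace, ← (Fin.consEquiv fun _ : Fin (n + 1) => α).sum_comp, Fintype.sum_prod_type]
  refine Finset.sum_congr rfl fun a _ => ?_
  rw [diag_apply, pow_succ_apply_eq_sum_prod]
  refine Finset.sum_congr rfl fun p _ => Finset.prod_congr rfl fun k _ => ?_
  simp only [Fin.consEquiv_apply]
  congr 1
  refine Fin.lastCases ?_ (fun k => ?_) k
  · simp
  · simp [Fin.coeSucc_eq_succ]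

variable {β : Type*} [Fintype β]

section Hashimoto

variable [DecidableEq β] {P : Matrix β α R} {Q : Matrix α β R} {J : Matrix β β R}

theorem mul_hashimoto_pow_succ_mul (hJ : J * J = 1) (k : ℕ) :
    Q * (P * Q - J) ^ (k + 2) * P =
      Q * (P * Q - J) ^ (k + 1) * P * (Q * P) - Q * (P * Q - J) ^ k * P * (Q * J * P - 1) := by
  have h : (P * Q - J) * (P * Q - J) * P =
      (P * Q - J) * P * (Q * P) - P * (Q * J * P - 1) := by
    calc (P * Q - J) * (P * Q - J) * P
        = (P * Q - J) * P * (Q * P) - P * (Q * J * P) + J * J * P := by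
          simp only [Matrix.sub_mul, Matrix.mul_sub, Matrix.mul_assoc]; abel
      _ = _ := by
          rw [hJ, Matrix.one_mul, Matrix.mul_sub, Matrix.mul_one]; abel
  calc Q * (P * Q - J) ^ (k + 2) * P
      = Q * (P * Q - J) ^ k * ((P * Q - J) * (P * Q - J) * P) := by
        simp only [pow_add, pow_two, Matrix.mul_assoc]
    _ = _ := by
        rw [h, pow_succ]
        generalize P * Q - J = B
        simp only [Matrix.mul_sub, Matrix.mul_assoc]

-- From `P * Q = B + J` and cyclicity of the trace. For darts, the term with `J` counts the closed
-- walks with a tail: the last dart reverses the first.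
omit [DecidableEq α] in
theorem trace_mul_hashimoto_pow_mul (k : ℕ) :
    (Q * (P * Q - J) ^ k * P).trace =
      ((P * Q - J) ^ (k + 1)).trace + ((P * Q - J) ^ k * J).trace := by
  rw [Matrix.mul_assoc, trace_mul_comm, Matrix.mul_assoc, ← trace_add, pow_succ,
    ← Matrix.mul_add, sub_add_cancel]

/-- For darts: removing the tail edge leaves a closed nonbacktracking walk. Conversely, a tail edge
can be attached in `deg - 2` ways, and in one more way if the walk already has a tail. -/
theorem trace_hashimoto_pow_mul_flip (hJ : J * J = 1) (k : ℕ) :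
    ((P * Q - J) ^ (k + 2) * J).trace =
      (Q * (P * Q - J) ^ k * P * (Q * J * P - 1)).trace - (Q * (P * Q - J) ^ k * P).trace
        + ((P * Q - J) ^ k * J).trace := by
  have h : (P * Q - J) * J * (P * Q - J) = P * (Q * J * P - 1) * Q - P * Q + J := by
    calc (P * Q - J) * J * (P * Q - J)
        = P * (Q * J * P) * Q - P * Q * (J * J) - J * J * (P * Q) + J * J * J := by
          simp only [Matrix.sub_mul, Matrix.mul_sub, Matrix.mul_assoc]; abel
      _ = _ := by
          rw [hJ]; simp only [Matrix.sub_mul, Matrix.mul_sub, Matrix.mul_one, Matrix.one_mul]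
  have h1 : ((P * Q - J) ^ (k + 2) * J).trace =
      ((P * Q - J) ^ k * ((P * Q - J) * J * (P * Q - J))).trace := by
    rw [show k + 2 = 1 + (k + 1) by ring, pow_add, pow_one, Matrix.mul_assoc, trace_mul_comm,
      pow_succ]
    simp only [Matrix.mul_assoc]
  have h2 : ∀ M : Matrix α α R, ((P * Q - J) ^ k * (P * M * Q)).trace =
      (Q * (P * Q - J) ^ k * P * M).trace := fun M => by
    rw [← Matrix.mul_assoc, trace_mul_comm]
    simp only [Matrix.mul_assoc]
  have h3 := h2 1
  rw [Matrix.mul_one, Matrix.mul_one] at h3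
  rw [h1, h, Matrix.mul_add, Matrix.mul_sub, trace_add, trace_sub, h2, h3]

/-- Closed nonbacktracking walks of length `k + 3` either have no tail, or arise from one of
length `k + 1` by adding a tail edge. -/
theorem trace_hashimoto_pow_recurrence (hJ : J * J = 1) (k : ℕ) :
    (Q * (P * Q - J) ^ (k + 2) * P).trace - ((P * Q - J) ^ (k + 3)).trace =
      (Q * (P * Q - J) ^ k * P * (Q * J * P - 1)).trace - ((P * Q - J) ^ (k + 1)).trace := by
  have h1 := trace_mul_hashimoto_pow_mul (P := P) (Q := Q) (J := J) (k + 2)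
  have h2 := trace_mul_hashimoto_pow_mul (P := P) (Q := Q) (J := J) k
  have h3 := trace_hashimoto_pow_mul_flip (P := P) (Q := Q) hJ k
  linear_combination h1 + h3 - h2

end Hashimoto

theorem IsHermitian.sum_eigenvalues_pow {A : Matrix α α ℝ} (hA : A.IsHermitian) (k : ℕ) :
    ∑ i, hA.eigenvalues i ^ k = (A ^ k).trace := by
  conv_rhs => rw [hA.spectral_theorem, ← map_pow, Unitary.conjStarAlgAut_apply, trace_mul_cycle]
  simp [diagonal_pow, trace_diagonal]

end Matrix

/-! ### The Hashimoto matrix of a graph. -/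

namespace SimpleGraph

variable {V : Type*} [Fintype V] [DecidableEq V] (G : SimpleGraph V) [DecidableRel G.Adj]

/-- The incidence matrix of darts with their end points. -/
def dartSndMatrix : Matrix G.Dart V ℝ := Matrix.of fun d v => if d.snd = v then 1 else 0

/-- The incidence matrix of darts with their starting points. -/
def dartFstMatrix : Matrix V G.Dart ℝ := Matrix.of fun v d => if d.fst = v then 1 else 0

/-- The permutation matrix that reverses darts. -/
def dartSymmMatrix : Matrix G.Dart G.Dart ℝ := Matrix.of fun d d' => if d' = d.symm then 1 else 0

/-- The Hashimoto nonbacktracking matrix. -/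
abbrev hashimotoMatrix : Matrix G.Dart G.Dart ℝ :=
  G.dartSndMatrix * G.dartFstMatrix - G.dartSymmMatrix

theorem dartSymmMatrix_mul_apply {α : Type*} (M : Matrix G.Dart α ℝ) (d : G.Dart) (a : α) :
    (G.dartSymmMatrix * M) d a = M d.symm a := by
  simp only [dartSymmMatrix, Matrix.mul_apply, Matrix.of_apply, ite_mul, one_mul, zero_mul,
    Finset.sum_ite_eq', Finset.mem_univ, if_true]

theorem dartSymmMatrix_mul_self : G.dartSymmMatrix * G.dartSymmMatrix = 1 := by
  ext d d'
  rw [dartSymmMatrix_mul_apply]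
  simp [dartSymmMatrix, Matrix.one_apply, eq_comm]

theorem dartFstMatrix_mul_dartSndMatrix :
    G.dartFstMatrix * G.dartSndMatrix = G.adjMatrix ℝ := by
  ext u v
  simp only [dartFstMatrix, dartSndMatrix, Matrix.mul_apply, Matrix.of_apply, adjMatrix_apply,
    mul_ite, mul_one, mul_zero, ← ite_and]
  split_ifs with h
  · rw [Finset.sum_eq_single ⟨(u, v), h⟩]
    · simp
    · rintro ⟨⟨a, b⟩, hab⟩ - hne
      rw [if_neg]
      rintro ⟨rfl, rfl⟩
      exact hne rfl
    · simp
  · refine Finset.sum_eq_zero fun d _ => if_neg ?_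
    rintro ⟨rfl, rfl⟩
    exact h d.adj

theorem dartFstMatrix_mul_dartSymmMatrix_mul_dartSndMatrix :
    G.dartFstMatrix * G.dartSymmMatrix * G.dartSndMatrix =
      Matrix.diagonal fun v => (G.degree v : ℝ) := by
  ext u v
  rw [Matrix.mul_assoc, Matrix.mul_apply]
  simp only [dartSymmMatrix_mul_apply]
  simp only [dartFstMatrix, dartSndMatrix, Matrix.of_apply, Dart.symm_toProd, Prod.snd_swap,
    mul_ite, mul_one, mul_zero, ← ite_and, Matrix.diagonal_apply]
  split_ifs with huv
  · subst huv
    simp only [and_self, Finset.sum_boole]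
    rw [← G.dart_fst_fiber_card_eq_degree u]
  · refine Finset.sum_eq_zero fun d _ => if_neg ?_
    rintro ⟨rfl, rfl⟩
    exact huv rfl

omit [DecidableRel G.Adj] in
theorem hashimotoMatrix_apply (d d' : G.Dart) :
    G.hashimotoMatrix d d' = if d.snd = d'.fst ∧ d' ≠ d.symm then 1 else 0 := by
  have h : d' = d.symm → d'.fst = d.snd := by rintro rfl; rfl
  simp only [hashimotoMatrix, Matrix.sub_apply, dartSndMatrix, dartFstMatrix, dartSymmMatrix,
    Matrix.mul_apply, Matrix.of_apply, ite_mul, one_mul, zero_mul, Finset.sum_ite_eq,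
    Finset.mem_univ, if_true]
  by_cases h1 : d' = d.symm
  · simp [h1]
  · simp [h1, eq_comm]

/-- Cyclic sequences of darts that follow one another without backtracking are the same as
cyclic sequences of vertices. -/
def dartCycleEquiv (n : ℕ) :
    {q : ZMod n → G.Dart // ∀ k, (q k).snd = (q (k + 1)).fst ∧ q (k + 1) ≠ (q k).symm} ≃
      {f : ZMod n → V // G.IsCyclicNonbacktracking f} where
  toFun q := ⟨fun k => (q.1 k).fst, fun k => by
    have h1 := q.2 k
    have h2 := q.2 (k + 1)
    refine ⟨by beta_reduce; rw [← h1.1]; exact (q.1 k).adj, fun he => h1.2 ?_⟩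
    rw [Dart.ext_iff]
    refine Prod.ext h1.1.symm ?_
    change (q.1 (k + 1)).snd = (q.1 k).fst
    rw [h2.1, add_assoc, one_add_one_eq_two]
    exact he.symm⟩
  invFun f := ⟨fun k => ⟨(f.1 k, f.1 (k + 1)), (f.2 k).1⟩, fun k => ⟨rfl, fun he => (f.2 k).2 (by
    have := congrArg (fun d : G.Dart => d.snd) he
    rw [show k + 2 = k + 1 + 1 by ring]
    exact this.symm)⟩⟩
  left_inv q := by
    refine Subtype.ext (funext fun k => ?_)
    rw [Dart.ext_iff]
    exact Prod.ext rfl (q.2 k).1.symm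
  right_inv f := rfl

theorem trace_hashimotoMatrix_pow (n : ℕ) [NeZero n] :
    (G.hashimotoMatrix ^ n).trace =
      Nat.card {f : ZMod n → V // G.IsCyclicNonbacktracking f} := by
  classical
  rw [Matrix.trace_pow_eq_sum_prod, ← Nat.card_congr (G.dartCycleEquiv n),
    Nat.card_eq_fintype_card, Fintype.card_subtype]
  simp only [hashimotoMatrix_apply, Finset.prod_boole, Finset.mem_univ, true_implies,
    Finset.sum_boole]

theorem trace_hashimotoMatrix_sq : (G.hashimotoMatrix ^ 2).trace = 0 := by
  have : IsEmpty {f : ZMod 2 → V // G.IsCyclicNonbacktracking f} :=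
    -- In `ZMod 2` the indices `0` and `0 + 2` coincide.
    ⟨fun f => (f.2 0).2 rfl⟩
  rw [trace_hashimotoMatrix_pow]
  simp

end SimpleGraph

/-! ### Nonbacktracking walk matrices and their restriction to one side. -/

namespace SimpleGraph

variable {V : Type*} [Fintype V] [DecidableEq V] (G : SimpleGraph V) [DecidableRel G.Adj]

/-- The matrix counting nonbacktracking walks of length `k + 1`. -/
def nonbacktrackingMatrix (k : ℕ) : Matrix V V ℝ :=
  G.dartFstMatrix * G.hashimotoMatrix ^ k * G.dartSndMatrix

/-- The diagonal matrix of degrees. -/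
def degreeMatrix : Matrix V V ℝ := Matrix.diagonal fun v => (G.degree v : ℝ)

theorem nonbacktrackingMatrix_zero : G.nonbacktrackingMatrix 0 = G.adjMatrix ℝ := by
  rw [nonbacktrackingMatrix, pow_zero, Matrix.mul_one, dartFstMatrix_mul_dartSndMatrix]

theorem nonbacktrackingMatrix_one :
    G.nonbacktrackingMatrix 1 = G.adjMatrix ℝ ^ 2 - G.degreeMatrix := by
  rw [nonbacktrackingMatrix, pow_one, Matrix.mul_sub, Matrix.sub_mul,
    dartFstMatrix_mul_dartSymmMatrix_mul_dartSndMatrix, ← Matrix.mul_assoc, Matrix.mul_assoc,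
    dartFstMatrix_mul_dartSndMatrix, pow_two, degreeMatrix]

theorem nonbacktrackingMatrix_add_two (k : ℕ) :
    G.nonbacktrackingMatrix (k + 2) = G.nonbacktrackingMatrix (k + 1) * G.adjMatrix ℝ -
      G.nonbacktrackingMatrix k * (G.degreeMatrix - 1) := by
  have := Matrix.mul_hashimoto_pow_succ_mul (P := G.dartSndMatrix) (Q := G.dartFstMatrix)
    G.dartSymmMatrix_mul_self k
  rwa [dartFstMatrix_mul_dartSndMatrix, dartFstMatrix_mul_dartSymmMatrix_mul_dartSndMatrix] at this

theorem trace_nonbacktrackingMatrix_add_two (k : ℕ) :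
    (G.nonbacktrackingMatrix (k + 2)).trace - (G.hashimotoMatrix ^ (k + 3)).trace =
      (G.nonbacktrackingMatrix k * (G.degreeMatrix - 1)).trace
        - (G.hashimotoMatrix ^ (k + 1)).trace := by
  have := Matrix.trace_hashimoto_pow_recurrence (P := G.dartSndMatrix) (Q := G.dartFstMatrix)
    G.dartSymmMatrix_mul_self k
  rwa [dartFstMatrix_mul_dartSymmMatrix_mul_dartSndMatrix] at this

/-- The coordinate projection onto the functions supported on `s`. -/
def coordProj (s : Finset V) : Matrix V V ℝ := Matrix.diagonal fun v => if v ∈ s then 1 else 0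

end SimpleGraph

namespace BiregularCycles.IsBiregularBipartite

open SimpleGraph

variable {V : Type*} [Fintype V] [DecidableEq V] {G : SimpleGraph V} [DecidableRel G.Adj]
  {U W : Finset V} {q₁ q₂ : ℕ}

theorem swap (hG : IsBiregularBipartite G U W q₁ q₂) : IsBiregularBipartite G W U q₂ q₁ :=
  ⟨hG.bipartite.symm, by rw [Finset.union_comm]; exact hG.cover, hG.degree_right, hG.degree_left⟩

theorem mem_right_iff (hG : IsBiregularBipartite G U W q₁ q₂) (v : V) : v ∈ W ↔ v ∉ U := by
  have h1 : v ∈ U ∪ W := by rw [hG.cover]; exact Finset.mem_univ v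
  have h2 : v ∈ U → v ∉ W := fun h =>
    Finset.disjoint_left.mp (Finset.disjoint_coe.mp hG.bipartite.disjoint) h
  rw [Finset.mem_union] at h1
  tauto

theorem mem_iff_of_adj (hG : IsBiregularBipartite G U W q₁ q₂) {u v : V} (h : G.Adj u v) :
    u ∈ W ↔ v ∈ U := by
  have := hG.bipartite.mem_of_adj h
  simp only [Finset.mem_coe] at this
  have h1 := hG.mem_right_iff u
  have h2 := hG.mem_right_iff v
  tauto

theorem coordProj_add (hG : IsBiregularBipartite G U W q₁ q₂) :
    coordProj U + coordProj W = 1 := by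
  rw [coordProj, coordProj, Matrix.diagonal_add, ← Matrix.diagonal_one]
  congr 1
  ext v
  by_cases h : v ∈ U <;> simp [hG.mem_right_iff, h]

theorem adjMatrix_mul_coordProj (hG : IsBiregularBipartite G U W q₁ q₂) :
    G.adjMatrix ℝ * coordProj U = coordProj W * G.adjMatrix ℝ := by
  ext u v
  rw [coordProj, coordProj, Matrix.mul_diagonal, Matrix.diagonal_mul, adjMatrix_apply]
  by_cases h : G.Adj u v
  · simp [h, hG.mem_iff_of_adj h]
  · simp [h]

theorem commute_adjMatrix_sq_coordProj (hG : IsBiregularBipartite G U W q₁ q₂) :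
    Commute (G.adjMatrix ℝ ^ 2) (coordProj U) := by
  rw [Commute, SemiconjBy, pow_two, Matrix.mul_assoc, hG.adjMatrix_mul_coordProj,
    ← Matrix.mul_assoc, hG.swap.adjMatrix_mul_coordProj, Matrix.mul_assoc]

theorem degreeMatrix_mul_coordProj (hG : IsBiregularBipartite G U W q₁ q₂) :
    G.degreeMatrix * coordProj U = ((q₁ : ℝ) + 1) • coordProj U := by
  rw [degreeMatrix, coordProj, Matrix.diagonal_mul_diagonal, ← Matrix.diagonal_smul]
  congr 1
  ext v
  by_cases h : v ∈ U
  · simp [h, hG.degree_left v h]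
  · simp [h]

theorem nonbacktrackingMatrix_one_mul (hG : IsBiregularBipartite G U W q₁ q₂) :
    G.nonbacktrackingMatrix 1 * coordProj U =
      coordProj U * G.adjMatrix ℝ ^ 2 - ((q₁ : ℝ) + 1) • coordProj U := by
  rw [nonbacktrackingMatrix_one, Matrix.sub_mul, hG.degreeMatrix_mul_coordProj,
    hG.commute_adjMatrix_sq_coordProj.eq]

theorem nonbacktrackingMatrix_add_two_mul (hG : IsBiregularBipartite G U W q₁ q₂) (k : ℕ) :
    G.nonbacktrackingMatrix (k + 2) * coordProj U =
      G.nonbacktrackingMatrix (k + 1) * coordProj W * G.adjMatrix ℝ -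
        (q₁ : ℝ) • (G.nonbacktrackingMatrix k * coordProj U) := by
  rw [nonbacktrackingMatrix_add_two, Matrix.sub_mul, Matrix.mul_assoc, Matrix.mul_assoc,
    hG.adjMatrix_mul_coordProj, Matrix.sub_mul, hG.degreeMatrix_mul_coordProj, Matrix.one_mul,
    add_smul, one_smul, add_sub_cancel_right, Matrix.mul_smul, Matrix.mul_assoc]

/-- The start of the two-step recurrence is irregular: walks of length two arise from `A ^ 2` by
subtracting the full degree `q₁ + 1`, hence the constant `q₂ * (q₁ + 1)` instead of `q₁ * q₂`. -/
theorem nonbacktrackingMatrix_three_mul (hG : IsBiregularBipartite G U W q₁ q₂) :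
    G.nonbacktrackingMatrix 3 * coordProj U =
      G.nonbacktrackingMatrix 1 * coordProj U * G.adjMatrix ℝ ^ 2 -
        ((q₁ : ℝ) + q₂) • (G.nonbacktrackingMatrix 1 * coordProj U) -
        ((q₂ : ℝ) * (q₁ + 1)) • coordProj U := by
  have h : coordProj U * G.adjMatrix ℝ ^ 2 =
      G.nonbacktrackingMatrix 1 * coordProj U + ((q₁ : ℝ) + 1) • coordProj U := by
    rw [hG.nonbacktrackingMatrix_one_mul, sub_add_cancel]
  rw [hG.nonbacktrackingMatrix_add_two_mul 1, hG.swap.nonbacktrackingMatrix_add_two_mul 0,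
    nonbacktrackingMatrix_zero, hG.swap.adjMatrix_mul_coordProj, Matrix.sub_mul, Matrix.smul_mul,
    Matrix.mul_assoc _ (G.adjMatrix ℝ) (G.adjMatrix ℝ),
    Matrix.mul_assoc _ (G.adjMatrix ℝ) (G.adjMatrix ℝ), ← pow_two, h]
  module

/-- Two single steps, one from each side, with the odd-length walk matrices eliminated. -/
theorem nonbacktrackingMatrix_add_four_mul (hG : IsBiregularBipartite G U W q₁ q₂) (k : ℕ) :
    G.nonbacktrackingMatrix (k + 4) * coordProj U =
      G.nonbacktrackingMatrix (k + 2) * coordProj U * G.adjMatrix ℝ ^ 2 -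
        ((q₁ : ℝ) + q₂) • (G.nonbacktrackingMatrix (k + 2) * coordProj U) -
        ((q₁ : ℝ) * q₂) • (G.nonbacktrackingMatrix k * coordProj U) := by
  have h : G.nonbacktrackingMatrix (k + 1) * coordProj W * G.adjMatrix ℝ =
      G.nonbacktrackingMatrix (k + 2) * coordProj U +
        (q₁ : ℝ) • (G.nonbacktrackingMatrix k * coordProj U) := by
    rw [hG.nonbacktrackingMatrix_add_two_mul, sub_add_cancel]
  rw [hG.nonbacktrackingMatrix_add_two_mul (k + 2),
    hG.swap.nonbacktrackingMatrix_add_two_mul (k + 1), Matrix.sub_mul, Matrix.smul_mul, h,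
    Matrix.mul_assoc _ (G.adjMatrix ℝ) (G.adjMatrix ℝ), ← pow_two]
  module

/-- Traces of powers of the squared adjacency matrix, restricted to one side. -/
theorem trace_coordProj_mul_pow_succ (hG : IsBiregularBipartite G U W q₁ q₂) (j : ℕ) :
    (coordProj U * (G.adjMatrix ℝ ^ 2) ^ (j + 1)).trace =
      (coordProj W * (G.adjMatrix ℝ ^ 2) ^ (j + 1)).trace := by
  have h : (G.adjMatrix ℝ ^ 2) ^ (j + 1) =
      -- One factor `A` is moved around the trace, which swaps the sides. This needs a positive
      -- power: at exponent zero the traces are the sizes of `U` and `W`.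
      G.adjMatrix ℝ * ((G.adjMatrix ℝ ^ 2) ^ j * G.adjMatrix ℝ) := by
    rw [← pow_mul, ← pow_mul, ← pow_succ, ← pow_succ']; congr 1
  conv_lhs => rw [h, ← Matrix.mul_assoc, ← hG.swap.adjMatrix_mul_coordProj, Matrix.mul_assoc,
    Matrix.trace_mul_comm, Matrix.mul_assoc, Matrix.mul_assoc]
  rw [← pow_two, ← pow_succ]

theorem trace_coordProj (U : Finset V) : (coordProj U).trace = U.card := by
  simp [coordProj, Matrix.trace_diagonal]

theorem trace_coordProj_mul_sq (hG : IsBiregularBipartite G U W q₁ q₂) :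
    (coordProj U * G.adjMatrix ℝ ^ 2).trace = (q₁ + 1) * U.card := by
  have : ∀ v, (coordProj U * G.adjMatrix ℝ ^ 2) v v = if v ∈ U then (q₁ : ℝ) + 1 else 0 := by
    intro v
    rw [coordProj, Matrix.diagonal_mul, pow_two, adjMatrix_mul_self_apply_self]
    by_cases h : v ∈ U
    · simp [h, hG.degree_left v h]
    · simp [h]
  simp only [Matrix.trace, Matrix.diag_apply, this, Finset.sum_ite_mem, Finset.univ_inter,
    Finset.sum_const, nsmul_eq_mul, mul_comm]

theorem card_edgeFinset (hG : IsBiregularBipartite G U W q₁ q₂) :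
    (G.edgeFinset.card : ℝ) = (q₁ + 1) * U.card := by
  rw [← isBipartiteWith_sum_degrees_eq_card_edges hG.bipartite, Finset.sum_congr rfl hG.degree_left]
  simp [mul_comm]

theorem biadjMatrix_mul_transpose (hG : IsBiregularBipartite G U W q₁ q₂) (w w' : W) :
    (biadjMatrix G U W * (biadjMatrix G U W).transpose) w w' = (G.adjMatrix ℝ ^ 2) w w' := by
  rw [pow_two, Matrix.mul_apply, Matrix.mul_apply]
  have h : ∀ v ∈ Finset.univ, v ∉ U → G.adjMatrix ℝ w v * G.adjMatrix ℝ v w' = 0 := by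
    intro v _ hv
    have : ¬ G.Adj w v := fun h => hv ((hG.mem_iff_of_adj h).mp w.2)
    simp [this]
  rw [← Finset.sum_subset (Finset.subset_univ U) h, 
    ← Finset.sum_coe_sort U fun v => G.adjMatrix ℝ w v * G.adjMatrix ℝ v w']
  refine Finset.sum_congr rfl fun u _ => ?_
  simp [biadjMatrix, adjMatrix_apply, G.adj_comm]

/-- `H Hᵀ` is the compression of `A ^ 2` to `W`. Compression respects powers because `A ^ 2`
commutes with the projection onto `W`. -/
theorem eigenvaluePowerSum_eq (hG : IsBiregularBipartite G U W q₁ q₂) (j : ℕ) :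
    eigenvaluePowerSum G U W j = (coordProj W * (G.adjMatrix ℝ ^ 2) ^ j).trace := by
  let I : Matrix W V ℝ := Matrix.of fun w v => if (w : V) = v then 1 else 0
  have hI : I * I.transpose = 1 := by
    ext w w'
    simp only [I, Matrix.mul_apply, Matrix.transpose_apply, Matrix.of_apply, Matrix.one_apply,
      Subtype.ext_iff, ite_mul, one_mul, zero_mul, Finset.sum_ite_eq, Finset.mem_univ, if_true]
    exact if_congr eq_comm rfl rfl
  have hI' : I.transpose * I = coordProj W := by
    ext v v'
    simp only [I, Matrix.mul_apply, Matrix.transpose_apply, Matrix.of_apply, coordProj,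
      Matrix.diagonal_apply, ite_mul, one_mul, zero_mul]
    rw [Finset.sum_coe_sort W fun w => if w = v then if w = v' then (1 : ℝ) else 0 else 0,
      Finset.sum_ite_eq']
    by_cases h : v = v' <;> simp [h]
  have hX : biadjMatrix G U W * (biadjMatrix G U W).transpose =
      I * G.adjMatrix ℝ ^ 2 * I.transpose := by
    ext w w'
    rw [hG.biadjMatrix_mul_transpose]
    simp [I, Matrix.mul_apply]
  have hpow : ∀ j, (I * G.adjMatrix ℝ ^ 2 * I.transpose) ^ j =
      I * (G.adjMatrix ℝ ^ 2) ^ j * I.transpose := by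
    intro j
    induction j with
    | zero => rw [pow_zero, pow_zero, Matrix.mul_one, hI]
    | succ j ih =>
      calc (I * G.adjMatrix ℝ ^ 2 * I.transpose) ^ (j + 1)
          = I * (G.adjMatrix ℝ ^ 2) ^ j * (I.transpose * I * G.adjMatrix ℝ ^ 2) *
              I.transpose := by
            rw [pow_succ (I * G.adjMatrix ℝ ^ 2 * I.transpose), ih]; simp only [Matrix.mul_assoc]
        _ = I * ((G.adjMatrix ℝ ^ 2) ^ j * G.adjMatrix ℝ ^ 2) *
              (I.transpose * (I * I.transpose)) := by
            rw [hI', ← hG.swap.commute_adjMatrix_sq_coordProj.eq, ← hI']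
            simp only [Matrix.mul_assoc]
        _ = _ := by rw [hI, Matrix.mul_one, pow_succ (G.adjMatrix ℝ ^ 2)]
  rw [eigenvaluePowerSum, Matrix.IsHermitian.sum_eigenvalues_pow, hX, hpow, Matrix.mul_assoc,
    Matrix.trace_mul_comm, Matrix.mul_assoc, hI',
    ((hG.swap.commute_adjMatrix_sq_coordProj).pow_left j).eq]

end BiregularCycles.IsBiregularBipartite

/-! ### The trace recurrence in terms of eigenvalue power sums. -/

namespace BiregularCycles

/-- The traces `tr (a_{2k+1} E Xʲ)`, where `a_{2k+1}` counts nonbacktracking walks of length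
`2k + 2`, `E` projects to one side of a biregular bipartite graph and `X` is the square of its
adjacency matrix, in terms of the power sums `m`. -/
def sideTrace (x y : ℝ) (m : ℕ → ℝ) : ℕ → ℕ → ℝ
  -- At `j = 0` the relation `m 1 = (x + 1) * tr E` removes `m 0`: it gives `0` here and turns `y *
  -- (x + 1) * m 0` into `y * m 1` below. Only positive indices remain, where both sides share the
  -- same `m`.
  | 0, 0 => 0
  | 0, j + 1 => m (j + 2) - (x + 1) * m (j + 1)
  | 1, 0 => sideTrace x y m 0 1 - (x + y) * sideTrace x y m 0 0 - y * m 1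
  | 1, j + 1 => sideTrace x y m 0 (j + 2) - (x + y) * sideTrace x y m 0 (j + 1) -
      y * (x + 1) * m (j + 1)
  | k + 2, j => sideTrace x y m (k + 1) (j + 1) - (x + y) * sideTrace x y m (k + 1) j -
      x * y * sideTrace x y m k j

namespace IsBiregularBipartite

open SimpleGraph

variable {V : Type*} [Fintype V] [DecidableEq V] {G : SimpleGraph V} [DecidableRel G.Adj]
  {U W : Finset V} {q₁ q₂ : ℕ}

theorem trace_nonbacktrackingMatrix_mul (hG : IsBiregularBipartite G U W q₁ q₂) {m : ℕ → ℝ}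
    (hm : ∀ j, m (j + 1) = (coordProj U * (G.adjMatrix ℝ ^ 2) ^ (j + 1)).trace) (k j : ℕ) :
    (G.nonbacktrackingMatrix (2 * k + 1) * coordProj U * (G.adjMatrix ℝ ^ 2) ^ j).trace =
      sideTrace q₁ q₂ m k j := by
  have hm1 : m 1 = (q₁ + 1) * (coordProj U).trace := by
    rw [hm 0, zero_add, pow_one, hG.trace_coordProj_mul_sq, trace_coordProj]
  have h0 : ∀ j, (G.nonbacktrackingMatrix 1 * coordProj U * (G.adjMatrix ℝ ^ 2) ^ j).trace =
      sideTrace q₁ q₂ m 0 j := by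
    intro j
    rw [hG.nonbacktrackingMatrix_one_mul, Matrix.sub_mul, Matrix.smul_mul, Matrix.mul_assoc,
      ← pow_succ', Matrix.trace_sub, Matrix.trace_smul, smul_eq_mul, ← hm]
    cases j with
    | zero => rw [pow_zero, Matrix.mul_one, zero_add, hm1, sub_self, sideTrace]
    | succ j => rw [← hm, sideTrace]
  have h1 : ∀ j, (G.nonbacktrackingMatrix 3 * coordProj U * (G.adjMatrix ℝ ^ 2) ^ j).trace =
      sideTrace q₁ q₂ m 1 j := by
    intro j
    rw [hG.nonbacktrackingMatrix_three_mul, Matrix.sub_mul, Matrix.sub_mul, Matrix.smul_mul,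
      Matrix.smul_mul, Matrix.mul_assoc _ (G.adjMatrix ℝ ^ 2), ← pow_succ', Matrix.trace_sub,
      Matrix.trace_sub, Matrix.trace_smul, Matrix.trace_smul, smul_eq_mul, smul_eq_mul, h0, h0]
    cases j with
    | zero =>
      rw [pow_zero, Matrix.mul_one]
      simp only [sideTrace, hm1]
      ring
    | succ j => simp only [← hm, sideTrace]
  induction k using Nat.twoStepInduction generalizing j with
  | zero => exact h0 j
  | one => exact h1 j
  | more k ih1 ih2 =>
    rw [show 2 * (k + 2) + 1 = 2 * k + 1 + 4 by ring, hG.nonbacktrackingMatrix_add_four_mul,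
      show 2 * k + 1 + 2 = 2 * (k + 1) + 1 by ring, Matrix.sub_mul, Matrix.sub_mul,
      Matrix.smul_mul, Matrix.smul_mul, Matrix.mul_assoc _ (G.adjMatrix ℝ ^ 2), ← pow_succ',
      Matrix.trace_sub, Matrix.trace_sub, Matrix.trace_smul, Matrix.trace_smul, smul_eq_mul,
      smul_eq_mul, ih1, ih2, ih2, sideTrace]

/-- Each trace is split by the two side projections; on each side the degree matrix minus one is the
scalar `q₁` or `q₂`. -/
theorem trace_hashimotoMatrix_recurrence (hG : IsBiregularBipartite G U W q₁ q₂) (k : ℕ) :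
    (G.hashimotoMatrix ^ (2 * (k + 1) + 2)).trace =
      sideTrace q₁ q₂ (eigenvaluePowerSum G U W) (k + 1) 0 +
      sideTrace q₂ q₁ (eigenvaluePowerSum G U W) (k + 1) 0 -
      q₁ * sideTrace q₁ q₂ (eigenvaluePowerSum G U W) k 0 -
      q₂ * sideTrace q₂ q₁ (eigenvaluePowerSum G U W) k 0 +
      (G.hashimotoMatrix ^ (2 * k + 2)).trace := by
  have hU := hG.trace_nonbacktrackingMatrix_mul (m := eigenvaluePowerSum G U W) fun j => by
    rw [hG.eigenvaluePowerSum_eq, hG.trace_coordProj_mul_pow_succ]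
  have hW := hG.swap.trace_nonbacktrackingMatrix_mul (m := eigenvaluePowerSum G U W) fun j => by
    rw [hG.eigenvaluePowerSum_eq]
  have hsplit : ∀ M : Matrix V V ℝ, M.trace = (M * coordProj U * (G.adjMatrix ℝ ^ 2) ^ 0).trace +
      (M * coordProj W * (G.adjMatrix ℝ ^ 2) ^ 0).trace := fun M => by
    rw [pow_zero, Matrix.mul_one, Matrix.mul_one, ← Matrix.trace_add, ← Matrix.mul_add,
      hG.coordProj_add, Matrix.mul_one]
  have hD : (G.degreeMatrix - 1) * coordProj U = (q₁ : ℝ) • coordProj U := by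
    rw [Matrix.sub_mul, hG.degreeMatrix_mul_coordProj, Matrix.one_mul]; module
  have hD' : (G.degreeMatrix - 1) * coordProj W = (q₂ : ℝ) • coordProj W := by
    rw [Matrix.sub_mul, hG.swap.degreeMatrix_mul_coordProj, Matrix.one_mul]; module
  have h := G.trace_nonbacktrackingMatrix_add_two (2 * k + 1)
  rw [hsplit (G.nonbacktrackingMatrix _), hsplit (_ * (G.degreeMatrix - 1)),
    Matrix.mul_assoc _ (G.degreeMatrix - 1), Matrix.mul_assoc _ (G.degreeMatrix - 1), hD, hD',
    Matrix.mul_smul, Matrix.mul_smul, Matrix.smul_mul, Matrix.smul_mul, Matrix.trace_smul,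
    Matrix.trace_smul, show 2 * k + 1 + 2 = 2 * (k + 1) + 1 by ring, hU, hU, hW, hW,
    smul_eq_mul, smul_eq_mul] at h
  rw [show 2 * (k + 1) + 2 = 2 * k + 1 + 3 by ring, show 2 * k + 2 = 2 * k + 1 + 1 by ring]
  linear_combination -h

theorem eigenvaluePowerSum_one (hG : IsBiregularBipartite G U W q₁ q₂) :
    eigenvaluePowerSum G U W 1 = (G.edgeFinset.card : ℝ) := by
  rw [hG.eigenvaluePowerSum_eq, pow_one, hG.swap.trace_coordProj_mul_sq, hG.swap.card_edgeFinset]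

end IsBiregularBipartite

end BiregularCycles

namespace SimpleGraph

variable {V : Type*} [Fintype V] [DecidableEq V] {G : SimpleGraph V} [DecidableRel G.Adj]

open BiregularCycles

theorem trace_hashimotoMatrix_pow_eq_numCycles {n : ℕ} (hn : 3 ≤ n) {g : ℕ}
    (hg : (g : ℕ∞) ≤ G.egirth) (hng : n < 2 * g) :
    (G.hashimotoMatrix ^ n).trace = 2 * n * numCycles G n := by
  have : NeZero n := ⟨by omega⟩
  rw [trace_hashimotoMatrix_pow, card_cyclicNonbacktracking hn hg hng]
  push_cast
  rfl

omit [Fintype V] [DecidableEq V] [DecidableRel G.Adj] in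
theorem numCycles_eq_zero {n : ℕ} (hn : (n : ℕ∞) < G.egirth) : numCycles G n = 0 := by
  have : {C : G.Subgraph | ∃ (v : V) (c : G.Walk v v),
      c.IsCycle ∧ c.length = n ∧ c.toSubgraph = C} = ∅ := by
    rw [Set.eq_empty_iff_forall_notMem]
    rintro C ⟨v, c, hc, rfl, -⟩
    exact absurd (egirth_le_length hc) (not_le.mpr hn)
  rw [numCycles, this, Set.ncard_empty]

end SimpleGraph

/-! ### Solving the recurrence for the power sums. -/

namespace BiregularCycles

/-- Nonnegativity keeps `x + 1` and `y + 1` nonzero, so the quotients become polynomials that `ring`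
can handle. -/
theorem A10_eq {x y : ℝ} (hx : 0 ≤ x) (hy : 0 ≤ y) :
    A10 x y = -1 + (x ^ 4 - x ^ 3 + x ^ 2 - x + 1) + (y ^ 4 - y ^ 3 + y ^ 2 - y + 1) -
      5 * (x ^ 4 + x ^ 3 * y + x ^ 2 * y ^ 2 + x * y ^ 3 + y ^ 4) +
      5 * (x + y) * A8 x y - a53 x y * A6 x y + a52 x y * A4 x y := by
  have h : ∀ z : ℝ, 0 ≤ z → (z ^ 5 + 1) / (z + 1) = z ^ 4 - z ^ 3 + z ^ 2 - z + 1 := fun z hz => by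
    rw [div_eq_iff (by positivity)]; ring
  rw [A10, h x hx, h y hy]
  simp only [powQuot, Finset.sum_range_succ, Finset.sum_range_zero]
  norm_num
  ring

theorem A12_eq {x y : ℝ} (hx : 0 ≤ x) (hy : 0 ≤ y) :
    A12 x y = -1 - (x ^ 5 - x ^ 4 + x ^ 3 - x ^ 2 + x - 1) -
      (y ^ 5 - y ^ 4 + y ^ 3 - y ^ 2 + y - 1) +
      6 * (x ^ 5 + x ^ 4 * y + x ^ 3 * y ^ 2 + x ^ 2 * y ^ 3 + x * y ^ 4 + y ^ 5) +
      6 * (x + y) * A10 x y - a64 x y * A8 x y + a63 x y * A6 x y - a62 x y * A4 x y := by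
  have h : ∀ z : ℝ, 0 ≤ z →
      (z ^ 6 - 1) / (z + 1) = z ^ 5 - z ^ 4 + z ^ 3 - z ^ 2 + z - 1 := fun z hz => by
    rw [div_eq_iff (by positivity)]; ring
  rw [A12, h x hx, h y hy]
  simp only [powQuot, Finset.sum_range_succ, Finset.sum_range_zero]
  norm_num
  ring

theorem A14_eq {x y : ℝ} (hx : 0 ≤ x) (hy : 0 ≤ y) :
    A14 x y = -1 + (x ^ 6 - x ^ 5 + x ^ 4 - x ^ 3 + x ^ 2 - x + 1) +
      (y ^ 6 - y ^ 5 + y ^ 4 - y ^ 3 + y ^ 2 - y + 1) -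
      7 * (x ^ 6 + x ^ 5 * y + x ^ 4 * y ^ 2 + x ^ 3 * y ^ 3 + x ^ 2 * y ^ 4 + x * y ^ 5 + y ^ 6) +
      7 * (x + y) * A12 x y - a75 x y * A10 x y + a74 x y * A8 x y - a73 x y * A6 x y +
      a72 x y * A4 x y := by
  have h : ∀ z : ℝ, 0 ≤ z →
      (z ^ 7 + 1) / (z + 1) = z ^ 6 - z ^ 5 + z ^ 4 - z ^ 3 + z ^ 2 - z + 1 := fun z hz => by
    rw [div_eq_iff (by positivity)]; ring
  rw [A14, h x hx, h y hy]
  simp only [powQuot, Finset.sum_range_succ, Finset.sum_range_zero]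
  norm_num
  ring

section Elimination

variable {x y : ℝ} {S t : ℕ → ℝ}

/-- The recurrence satisfied by the numbers `t (k + 1)` of closed walks of length `2k + 2`
that backtrack nowhere, in terms of the eigenvalue power sums. -/
structure TraceRecurrence (x y : ℝ) (S t : ℕ → ℝ) : Prop where
  one : t 1 = 0
  succ : ∀ k, t (k + 2) = sideTrace x y S (k + 1) 0 + sideTrace y x S (k + 1) 0 -
    x * sideTrace x y S k 0 - y * sideTrace y x S k 0 + t (k + 1)

namespace TraceRecurrence

/-- In this and the following lemmas, the newest power sum enters the recurrence with coefficient 2,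
one from each side; hence the division by `2`. -/
theorem powerSum_two (h : TraceRecurrence x y S t) : S 2 = S 1 * A4 x y + t 2 / 2 := by
  have h2 := h.succ 0
  simp only [sideTrace, h.one, zero_add] at h2
  rw [A4]
  linear_combination -h2 / 2

theorem powerSum_three (h : TraceRecurrence x y S t) :
    S 3 = S 1 * A6 x y + t 3 / 2 + 3 / 2 * (x + y) * t 2 := by
  have h2 := h.succ 1
  simp only [sideTrace, zero_add, Nat.reduceAdd, h.powerSum_two] at h2
  simp only [A4, A6] at h2 ⊢
  linear_combination -h2 / 2

theorem powerSum_four (h : TraceRecurrence x y S t) (h2 : t 2 = 0) :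
    S 4 = S 1 * A8 x y + t 4 / 2 + 2 * (x + y) * t 3 := by
  have h3 := h.succ 2
  simp only [sideTrace, zero_add, Nat.reduceAdd, h.powerSum_two, h.powerSum_three, h2] at h3
  simp only [A4, A6, A8] at h3 ⊢
  linear_combination -h3 / 2

theorem powerSum_five (h : TraceRecurrence x y S t) (hx : 0 ≤ x) (hy : 0 ≤ y) (h2 : t 2 = 0) :
    S 5 = S 1 * A10 x y + t 5 / 2 + 5 / 2 * (x + y) * t 4 +
      5 / 2 * (2 * (x + y) ^ 2 + x * y) * t 3 := by
  have h3 := h.succ 3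
  simp only [sideTrace, zero_add, Nat.reduceAdd, h.powerSum_two, h.powerSum_three,
    h.powerSum_four h2, h2] at h3
  rw [A10_eq hx hy]
  simp only [A4, A6, A8, a53, a52] at h3 ⊢
  linear_combination -h3 / 2

theorem powerSum_six (h : TraceRecurrence x y S t) (hx : 0 ≤ x) (hy : 0 ≤ y) (h2 : t 2 = 0)
    (h3 : t 3 = 0) :
    S 6 = S 1 * A12 x y + t 6 / 2 + 3 * (x + y) * t 5 +
      3 / 2 * (5 * (x + y) ^ 2 + 2 * (x * y)) * t 4 := by
  have h4 := h.succ 4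
  simp only [sideTrace, zero_add, Nat.reduceAdd, h.powerSum_two, h.powerSum_three,
    h.powerSum_four h2, h.powerSum_five hx hy h2, h2, h3] at h4
  rw [A12_eq hx hy]
  rw [A10_eq hx hy] at h4 ⊢
  simp only [A4, A6, A8, a53, a52, a64, a63, a62] at h4 ⊢
  linear_combination -h4 / 2

theorem powerSum_seven (h : TraceRecurrence x y S t) (hx : 0 ≤ x) (hy : 0 ≤ y) (h2 : t 2 = 0)
    (h3 : t 3 = 0) :
    S 7 = S 1 * A14 x y + t 7 / 2 + 7 / 2 * (x + y) * t 6 +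
      7 / 2 * (3 * (x + y) ^ 2 + x * y) * t 5 +
      7 / 2 * (x + y) * (5 * (x + y) ^ 2 + 6 * (x * y)) * t 4 := by
  have h4 := h.succ 5
  simp only [sideTrace, zero_add, Nat.reduceAdd, h.powerSum_two, h.powerSum_three,
    h.powerSum_four h2, h.powerSum_five hx hy h2, h.powerSum_six hx hy h2 h3, h2, h3] at h4
  rw [A14_eq hx hy]
  rw [A12_eq hx hy, A10_eq hx hy] at h4 ⊢
  simp only [A4, A6, A8, a53, a52, a64, a63, a62, a75, a74, a73, a72] at h4 ⊢
  linear_combination -h4 / 2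

end TraceRecurrence

end Elimination

end BiregularCycles

open BiregularCycles in
theorem mainTheorem2 {V : Type*} [Fintype V] [DecidableEq V] (G : SimpleGraph V)
    [DecidableRel G.Adj] (U W : Finset V) (q₁ q₂ : ℕ)
    (hG : IsBiregularBipartite G U W q₁ q₂) :
    let N : ℕ → ℝ := fun l => (numCycles G l : ℝ)
    let S : ℕ → ℝ := eigenvaluePowerSum G U W
    let e : ℝ := (G.edgeFinset.card : ℝ)
    let x : ℝ := q₁
    let y : ℝ := q₂
    (4 ≤ G.egirth →
      N 4 = (S 2 - e * A4 x y) / 4 ∧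
      N 6 = -2 * (x + y) * N 4 + (S 3 - e * A6 x y) / 6) ∧
    (6 ≤ G.egirth →
      N 8 = -3 * (x + y) * N 6 + (S 4 - e * A8 x y) / 8 ∧
      N 10 = -4 * (x + y) * N 8 - 3 * (2 * (x + y) ^ 2 + x * y) * N 6
        + (S 5 - e * A10 x y) / 10) ∧
    (8 ≤ G.egirth →
      N 12 = -5 * (x + y) * N 10 - 2 * (5 * (x + y) ^ 2 + 2 * (x * y)) * N 8
        + (S 6 - e * A12 x y) / 12 ∧
      N 14 = -6 * (x + y) * N 12 - 5 * (3 * (x + y) ^ 2 + x * y) * N 10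
        - 4 * (x + y) * (5 * (x + y) ^ 2 + 6 * (x * y)) * N 8
        + (S 7 - e * A14 x y) / 14) := by
  intro N S e x y
  have he : S 1 = e := hG.eigenvaluePowerSum_one
  have h : TraceRecurrence x y S fun k => (G.hashimotoMatrix ^ (2 * k)).trace :=
    ⟨G.trace_hashimotoMatrix_sq, fun k => hG.trace_hashimotoMatrix_recurrence k⟩
  have hx : 0 ≤ x := q₁.cast_nonneg
  have hy : 0 ≤ y := q₂.cast_nonneg
  -- The factor is `2n` with `n = 2 * k`, and `k < g` is the condition `n < 2g`.
  have hN : ∀ g : ℕ, (g : ℕ∞) ≤ G.egirth → ∀ k, 2 ≤ k → k < g →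
      (G.hashimotoMatrix ^ (2 * k)).trace = 4 * k * N (2 * k) := fun g hg k hk hkg => by
    rw [SimpleGraph.trace_hashimotoMatrix_pow_eq_numCycles (by omega) hg (by omega)]
    push_cast
    ring
  have hzero : ∀ g : ℕ, (g : ℕ∞) ≤ G.egirth → ∀ n : ℕ, n < g → N n = 0 := fun g hg n hn => by
    simp only [N, Nat.cast_eq_zero]
    exact SimpleGraph.numCycles_eq_zero (lt_of_lt_of_le (by exact_mod_cast hn) hg)
  refine ⟨fun hg => ?_, fun hg => ?_, fun hg => ?_⟩
  · have t2 := hN 4 hg 2 (by norm_num) (by norm_num)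
    have t3 := hN 4 hg 3 (by norm_num) (by norm_num)
    have s2 := h.powerSum_two
    have s3 := h.powerSum_three
    simp only [t2, t3, he] at s2 s3
    norm_num at s2 s3
    exact ⟨by linear_combination -s2 / 4, by linear_combination -s3 / 6⟩
  · have t2 := hN 6 hg 2 (by norm_num) (by norm_num)
    have t3 := hN 6 hg 3 (by norm_num) (by norm_num)
    have t4 := hN 6 hg 4 (by norm_num) (by norm_num)
    have t5 := hN 6 hg 5 (by norm_num) (by norm_num)
    -- Girth at least 6 leaves no 4-cycles, so `t 2` vanishes.
    rw [hzero 6 hg (2 * 2) (by norm_num), mul_zero] at t2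
    have s4 := h.powerSum_four t2
    have s5 := h.powerSum_five hx hy t2
    simp only [t3, t4, t5, he] at s4 s5
    norm_num at s4 s5
    exact ⟨by linear_combination -s4 / 8, by linear_combination -s5 / 10⟩
  · have t2 := hN 8 hg 2 (by norm_num) (by norm_num)
    have t3 := hN 8 hg 3 (by norm_num) (by norm_num)
    have t4 := hN 8 hg 4 (by norm_num) (by norm_num)
    have t5 := hN 8 hg 5 (by norm_num) (by norm_num)
    have t6 := hN 8 hg 6 (by norm_num) (by norm_num)
    have t7 := hN 8 hg 7 (by norm_num) (by norm_num)
    -- Girth at least 8 excludes both 4-cycles and 6-cycles.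
    rw [hzero 8 hg (2 * 2) (by norm_num), mul_zero] at t2
    rw [hzero 8 hg (2 * 3) (by norm_num), mul_zero] at t3
    have s6 := h.powerSum_six hx hy t2 t3
    have s7 := h.powerSum_seven hx hy t2 t3
    simp only [t4, t5, t6, t7, he] at s6 s7
    norm_num at s6 s7
    exact ⟨by linear_combination -s6 / 12, by linear_combination -s7 / 14⟩
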